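/- Let $R$ be a Prüfer domain (an integral domain in which every nonzero finitely generated ideal is invertible) with quotient field $K$, and suppose that $R$ is either (a) semilocal, i.e. $R$ has only finitely many maximal ideals; or (b) of finite Krull dimension and of finite character, i.e. every nonzero $x\in R$ is a nonunit in only finitely many of the localizations $R_M$, where $M$ ranges over the maximal ideals of $R$. Let $\star$ be a star operation on $R$, i.e. a map $I\mapsto I^\star$ from the set of fractional ideals of $R$ to itself such that, for all fractional ideals $I,J$ and all $x\in K$: $I\subseteq I^\star$; $(I^\star)^\star=I^\star$; $I\subseteq J$ implies $I^\star\subseteq J^\star$; $R^\star=R$; and $(xI)^\star=x\cdot I^\star$. Let $\mathrm{Inv}^\star(R)$ be the set of $\star$-invertible $\star$-ideals, i.e. of the fractional ideals $I$ of $R$ such that $I=I^\star$ and $(I(R:I))^\star=R$, where $(R:I)=\{x\in K\mid xI\subseteq R\}$. If $I,J\in\mathrm{Inv}^\star(R)$, then $I+J\in\mathrm{Inv}^\star(R)$. -/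

import Mathlib

open scoped nonZeroDivisors

/-- A domain is a *Prüfer domain* if each of its nonzero finitely generated ideals is invertible
(as a fractional ideal). -/
def IsPruferDomain (R : Type*) [CommRing R] [IsDomain R] : Prop :=
  ∀ I : Ideal R, I ≠ ⊥ → I.FG → IsUnit (I : FractionalIdeal R⁰ (FractionRing R))

/-- A commutative ring is *semilocal* if it has only finitely many maximal ideals. -/
def IsSemilocal (R : Type*) [CommRing R] : Prop :=
  Finite (MaximalSpectrum R)

/-- A domain `R` is *of finite character* if each nonzero `x` in `R` is a nonunit in only finitely
many of the localizations `R_M`, where `M` ranges over the maximal ideals of `R`. -/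
def HasFiniteCharacter (R : Type*) [CommRing R] [IsDomain R] : Prop :=
  ∀ x : R, x ≠ 0 →
    {M : MaximalSpectrum R |
      ¬ IsUnit (algebraMap R (Localization.AtPrime M.asIdeal) x)}.Finite

/-- A *star operation* on the domain `R` with quotient field `K`. Mathlib's fractional ideals
include the zero ideal; `map_smul` with `x = 0` says that the zero ideal is sent to itself, so
this is the same as a star operation on the nonzero fractional ideals. -/
@[ext]
structure StarOperation (R K : Type*) [CommRing R] [IsDomain R] [Field K] [Algebra R K]
    [IsFractionRing R K] where
  /-- The underlying map on fractional ideals. -/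
  toFun : FractionalIdeal R⁰ K → FractionalIdeal R⁰ K
  le_map : ∀ I, I ≤ toFun I
  map_map : ∀ I, toFun (toFun I) = toFun I
  mono : ∀ I J, I ≤ J → toFun I ≤ toFun J
  map_one : toFun 1 = 1
  map_smul : ∀ (x : K) (I : FractionalIdeal R⁰ K),
    toFun (FractionalIdeal.spanSingleton R⁰ x * I) =
      FractionalIdeal.spanSingleton R⁰ x * toFun I

namespace StarOperation

variable {R K : Type*} [CommRing R] [IsDomain R] [Field K] [Algebra R K] [IsFractionRing R K]

/-- `I` is a `⋆`-ideal if it is equal to its closure. -/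
def IsStarIdeal (s : StarOperation R K) (I : FractionalIdeal R⁰ K) : Prop :=
  I = s.toFun I

/-- `I` is `⋆`-invertible if the closure of `I (R : I)` is `R`. Here `1 / I` is `(R : I)`; Mathlib
sets `1 / 0 = 0`, but the product with `0` is `0` in any case, so `0` is never `⋆`-invertible. -/
def IsStarInvertible (s : StarOperation R K) (I : FractionalIdeal R⁰ K) : Prop :=
  s.toFun (I * (1 / I)) = 1

/-- The set of all `⋆`-invertible `⋆`-ideals. -/
def Inv (s : StarOperation R K) : Set (FractionalIdeal R⁰ K) :=
  {I | s.IsStarIdeal I ∧ s.IsStarInvertible I}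

end StarOperation

/-! ### Colon ideals and local membership -/

namespace FractionalIdeal

section Basic

variable {R K : Type*} [CommRing R] [Field K] [Algebra R K]

/-! That `I + J` is ⋆-invertible is a local check in valuation rings. For closedness, take `x ∈ (I +
J)^⋆` and `L = (I + J : x)`; ⋆-invertibility gives `L^⋆ = R`. Suppose `L ⊆ M` with `M` maximal, so
`M^⋆ = R` too. By `exists_mul_mem_of_toFun_eq_one`, `L_M = M_M`: otherwise `L` would lie in a proper
two-generated ideal, which is invertible, hence ⋆-closed. So `M x ⊆ I_M + J_M`, and since `R_M` is a
valuation ring, `M x` lies in `I_M` or in `J_M`. As `I` and `J` are ⋆-ideals,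
`IsStarIdeal.exists_smul_mem` puts `x` itself there, so `L` meets the complement of `M`, a
contradiction.

Cases (a) and (b) enter only through two consequences: nonzero elements lie in finitely many maximal
ideals, and `HasIsolatedMaximals`. Localization at `M` is expressed by multipliers `t ∉ M`. -/

theorem smul_mem_of_mem {I : FractionalIdeal R⁰ K} {x : K} (r : R) (hx : x ∈ I) : r • x ∈ I :=
  (I : Submodule R K).smul_mem r hx

theorem add_mem_of_mem {I : FractionalIdeal R⁰ K} {x y : K} (hx : x ∈ I) (hy : y ∈ I) :
    x + y ∈ I :=
  (I : Submodule R K).add_mem hx hy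

/-- The ideal of all `r` in `R` with `r • x ∈ I`. -/
def elementColon (I : FractionalIdeal R⁰ K) (x : K) : Ideal R :=
  Submodule.comap (LinearMap.toSpanSingleton R K x) (I : Submodule R K)

theorem mem_elementColon {I : FractionalIdeal R⁰ K} {x : K} {r : R} :
    r ∈ I.elementColon x ↔ r • x ∈ I :=
  Iff.rfl

/-- Membership in a fractional ideal is a local property. -/
theorem mem_of_forall_isMaximal {I : FractionalIdeal R⁰ K} {x : K}
    (h : ∀ M : Ideal R, M.IsMaximal → ∃ t ∉ M, t • x ∈ I) : x ∈ I := by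
  by_contra hx
  have hne : I.elementColon x ≠ ⊤ := fun htop =>
    hx (by simpa [mem_elementColon] using (Ideal.eq_top_iff_one _).1 htop)
  obtain ⟨M, hM, hle⟩ := Ideal.exists_le_maximal _ hne
  obtain ⟨t, ht, htx⟩ := h M hM
  exact ht (hle (mem_elementColon.2 htx))

end Basic

variable {R K : Type*} [CommRing R] [IsDomain R] [Field K] [Algebra R K] [IsFractionRing R K]

theorem elementColon_ne_bot {I : FractionalIdeal R⁰ K} (hI : I ≠ 0) (x : K) :
    I.elementColon x ≠ ⊥ := by
  obtain ⟨i, hi, hi0⟩ : ∃ i ∈ I, i ≠ 0 := by simpa [ne_eq, eq_zero_iff] using hI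
  by_cases hx : x = 0
  · refine (Submodule.ne_bot_iff _).2 ⟨1, ?_, one_ne_zero⟩
    rw [mem_elementColon, hx, smul_zero]
    exact (I : Submodule R K).zero_mem
  obtain ⟨a, b, hb, hab⟩ := IsFractionRing.div_surjective (A := R) (i / x)
  have hb0 : algebraMap R K b ≠ 0 := IsFractionRing.to_map_ne_zero_of_mem_nonZeroDivisors hb
  have key : a • x = b • i := by
    rw [Algebra.smul_def, Algebra.smul_def]
    field_simp at hab
    linear_combination hab
  refine (Submodule.ne_bot_iff _).2 ⟨a, ?_, ?_⟩
  · rw [mem_elementColon, key]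
    exact smul_mem_of_mem b hi
  · rintro rfl
    rw [zero_smul, Algebra.smul_def] at key
    exact (mul_ne_zero hb0 hi0) key.symm

end FractionalIdeal

open FractionalIdeal

/-! ### Prüfer domains are locally valuation rings -/

section Prufer

variable {R : Type*} [CommRing R] [IsDomain R]

theorem IsPruferDomain.isUnit_coeIdeal (hR : IsPruferDomain R) (K : Type*) [Field K] [Algebra R K]
    [IsFractionRing R K] {I : Ideal R} (h0 : I ≠ ⊥) (hfg : I.FG) :
    IsUnit (I : FractionalIdeal R⁰ K) := by
  have h := (hR I h0 hfg).map (canonicalEquiv R⁰ (FractionRing R) K)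
  rwa [canonicalEquiv_coeIdeal] at h

/-- In a Prüfer domain, divisibility is locally a total relation. -/
theorem IsPruferDomain.exists_mul_eq (hR : IsPruferDomain R) {M : Ideal R} (hM : M.IsPrime)
    (a b : R) : ∃ t ∉ M, (∃ c, t * a = c * b) ∨ ∃ c, t * b = c * a := by
  by_cases ha : a = 0
  · exact ⟨1, hM.one_notMem, Or.inl ⟨0, by simp [ha]⟩⟩
  have ha' : algebraMap R (FractionRing R) a ≠ 0 := by simpa using ha
  have hmem : ∀ z ∈ Ideal.span {a, b}, algebraMap R (FractionRing R) z ∈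
      ((Ideal.span {a, b} : Ideal R) : FractionalIdeal R⁰ (FractionRing R)) := fun z hz =>
    mem_coeIdeal_of_mem _ hz
  have ha1 : a ∈ Ideal.span {a, b} := Ideal.subset_span (by simp)
  have hb1 : b ∈ Ideal.span {a, b} := Ideal.subset_span (by simp)
  obtain ⟨J, hJ⟩ := (hR (Ideal.span {a, b})
    ((Submodule.ne_bot_iff _).2 ⟨a, ha1, ha⟩)
    (Submodule.fg_span (by simp))).exists_right_inv
  have hint : ∀ z ∈ Ideal.span {a, b}, ∀ u ∈ J, ∃ r,
      algebraMap R (FractionRing R) r = algebraMap R (FractionRing R) z * u := by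
    intro z hz u hu
    have := mul_mem_mul (hmem z hz) hu
    rwa [hJ, mem_one_iff] at this
  have hone : (1 : FractionRing R) ∈
      ((Ideal.span {a, b} : Ideal R) : FractionalIdeal R⁰ (FractionRing R)) * J := by
    rw [hJ]
    exact one_mem_one _
  have hsum : ∃ u ∈ J, ∃ v ∈ J, (1 : FractionRing R) =
      algebraMap R (FractionRing R) a * u + algebraMap R (FractionRing R) b * v := by
    refine FractionalIdeal.mul_induction_on hone ?_ ?_
    · intro i hi j hj
      obtain ⟨z, hz, rfl⟩ := (mem_coeIdeal _).1 hi
      obtain ⟨c, d, rfl⟩ := Ideal.mem_span_pair.1 hz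
      refine ⟨c • j, smul_mem_of_mem c hj, d • j, smul_mem_of_mem d hj, ?_⟩
      simp only [Algebra.smul_def, map_add, map_mul]
      ring
    · rintro x y ⟨u, hu, v, hv, rfl⟩ ⟨u', hu', v', hv', rfl⟩
      exact ⟨u + u', add_mem_of_mem hu hu', v + v', add_mem_of_mem hv hv', by ring⟩
  obtain ⟨u, hu, v, hv, huv⟩ := hsum
  obtain ⟨p, hp⟩ := hint a ha1 u hu
  obtain ⟨q, hq⟩ := hint b hb1 v hv
  obtain ⟨p', hp'⟩ := hint b hb1 u hu
  obtain ⟨q', hq'⟩ := hint a ha1 v hv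
  have hinj := IsFractionRing.injective R (FractionRing R)
  have hpq : p + q = 1 := hinj (by rw [map_add, hp, hq, map_one, huv])
  -- Here `p = a u` and `q = b v` sum to `1`, so one of them is outside `M` and serves as `t`.
  by_cases hpM : p ∈ M
  · refine ⟨q, fun hqM => hM.one_notMem (hpq ▸ M.add_mem hpM hqM), Or.inl ⟨q', hinj ?_⟩⟩
    rw [map_mul, map_mul, hq, hq']
    ring
  · refine ⟨p, hpM, Or.inr ⟨p', hinj ?_⟩⟩
    rw [map_mul, map_mul, hp, hp']
    ring

theorem IsPruferDomain.exists_smul_eq (hR : IsPruferDomain R) {K : Type*} [Field K] [Algebra R K]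
    [IsFractionRing R K] {M : Ideal R} (hM : M.IsPrime) (x y : K) :
    ∃ t ∉ M, (∃ c : R, t • x = c • y) ∨ ∃ c : R, t • y = c • x := by
  classical
  obtain ⟨d, hd⟩ := IsLocalization.exist_integer_multiples_of_finset R⁰ (insert x (singleton y))
  obtain ⟨a, ha⟩ := hd x (by simp)
  obtain ⟨b, hb⟩ := hd y (by simp)
  have hd0 : algebraMap R K d ≠ 0 := IsFractionRing.to_map_ne_zero_of_mem_nonZeroDivisors d.2
  rw [Algebra.smul_def] at ha hb
  obtain ⟨t, ht, ⟨c, hc⟩ | ⟨c, hc⟩⟩ := hR.exists_mul_eq hM a b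
  · refine ⟨t, ht, Or.inl ⟨c, mul_left_cancel₀ hd0 ?_⟩⟩
    have := congrArg (algebraMap R K) hc
    rw [map_mul, map_mul, ha, hb] at this
    rw [Algebra.smul_def, Algebra.smul_def]
    linear_combination this
  · refine ⟨t, ht, Or.inr ⟨c, mul_left_cancel₀ hd0 ?_⟩⟩
    have := congrArg (algebraMap R K) hc
    rw [map_mul, map_mul, ha, hb] at this
    rw [Algebra.smul_def, Algebra.smul_def]
    linear_combination this

/-- The primes contained in a given prime of a Prüfer domain form a chain. -/
theorem IsPruferDomain.le_total_of_le_prime (hR : IsPruferDomain R) {M P Q : Ideal R}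
    (hM : M.IsPrime) (hP : P.IsPrime) (hQ : Q.IsPrime) (hPM : P ≤ M) (hQM : Q ≤ M) :
    P ≤ Q ∨ Q ≤ P := by
  by_contra! h
  obtain ⟨a, haP, haQ⟩ := SetLike.not_le_iff_exists.1 h.1
  obtain ⟨b, hbQ, hbP⟩ := SetLike.not_le_iff_exists.1 h.2
  obtain ⟨t, ht, ⟨c, hc⟩ | ⟨c, hc⟩⟩ := hR.exists_mul_eq hM a b
  · exact (hQ.mem_or_mem (hc ▸ Q.mul_mem_left c hbQ)).elim (fun h => ht (hQM h)) haQ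
  · exact (hP.mem_or_mem (hc ▸ P.mul_mem_left c haP)).elim (fun h => ht (hPM h)) hbP

end Prufer

/-! ### Prime avoidance and isolated maximal ideals -/

section Maximal

variable {R : Type*} [CommRing R]

theorem Ideal.exists_mem_forall_notMem_of_finite {I : Ideal R} {T : Set (Ideal R)} (hT : T.Finite)
    (hprime : ∀ N ∈ T, N.IsPrime) (hle : ∀ N ∈ T, ¬ I ≤ N) : ∃ b ∈ I, ∀ N ∈ T, b ∉ N := by
  by_contra! h
  obtain ⟨N, hN, hIN⟩ := (Ideal.subset_union_prime (s := hT.toFinset) (f := id) (I := I) ⊥ ⊥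
    (fun N hN _ _ => hprime N (hT.mem_toFinset.1 hN))).1 (fun b hb => by
      obtain ⟨N, hN, hbN⟩ := h b hb
      exact Set.mem_biUnion (hT.mem_toFinset.2 hN) hbN)
  exact hle N (hT.mem_toFinset.1 hN) hIN

/-- An ideal that is contained in no prime below both `M` and `N` contains a product of an element
outside `M` and an element outside `N`. -/
theorem Ideal.exists_mul_mem_of_forall_isPrime {M N : Ideal R} (hM : M.IsPrime) (hN : N.IsPrime)
    {I : Ideal R} (h : ∀ P : Ideal R, P.IsPrime → P ≤ M → P ≤ N → ¬ I ≤ P) :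
    ∃ t ∉ M, ∃ r ∉ N, t * r ∈ I := by
  by_contra! hI
  obtain ⟨P, hP, hIP, hdisj⟩ := Ideal.exists_le_prime_disjoint I (M.primeCompl ⊔ N.primeCompl)
    (Set.disjoint_left.2 fun x hx hx' => by
      obtain ⟨t, ht, r, hr, rfl⟩ := Submonoid.mem_sup.1 hx'
      exact hI t ht r hr hx)
  rw [Set.disjoint_left] at hdisj
  refine h P hP (fun x hx => ?_) (fun x hx => ?_) hIP
  · by_contra hxM
    exact hdisj hx (Submonoid.mem_sup_left (show x ∈ M.primeCompl from hxM))
  · by_contra hxN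
    exact hdisj hx (Submonoid.mem_sup_right (show x ∈ N.primeCompl from hxN))

theorem IsSemilocal.finite_setOf_isMaximal (h : IsSemilocal R) :
    {M : Ideal R | M.IsMaximal}.Finite := by
  have : Finite (MaximalSpectrum R) := h
  refine (Set.finite_range (MaximalSpectrum.asIdeal (R := R))).subset fun M hM => ⟨⟨M, hM⟩, rfl⟩

theorem HasFiniteCharacter.finite_setOf_mem [IsDomain R] (h : HasFiniteCharacter R) {x : R}
    (hx : x ≠ 0) : {M : Ideal R | M.IsMaximal ∧ x ∈ M}.Finite := by
  refine ((h x hx).image MaximalSpectrum.asIdeal).subset ?_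
  rintro M ⟨hM, hxM⟩
  refine ⟨⟨M, hM⟩, ?_, rfl⟩
  rw [Set.mem_ofPred_eq, IsLocalization.AtPrime.isUnit_to_map_iff (Localization.AtPrime M) M]
  exact fun h => h hxM

/-- Each nonzero maximal ideal has an element that lies in no prime common to it and to another
maximal ideal. -/
def HasIsolatedMaximals (R : Type*) [CommRing R] : Prop :=
  ∀ M : Ideal R, M.IsMaximal → M ≠ ⊥ → ∃ q ∈ M, ∀ N : Ideal R, N.IsMaximal → N ≠ M →
    ∀ P : Ideal R, P.IsPrime → P ≤ M → P ≤ N → q ∉ P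

theorem IsSemilocal.hasIsolatedMaximals (h : IsSemilocal R) : HasIsolatedMaximals R := by
  intro M hM _
  obtain ⟨q, hq, hqN⟩ := Ideal.exists_mem_forall_notMem_of_finite (I := M)
    (T := {N | N.IsMaximal ∧ N ≠ M})
    (h.finite_setOf_isMaximal.subset fun N hN => hN.1) (fun N hN => hN.1.isPrime)
    (fun N hN hle => hN.2 (hM.eq_of_le hN.1.ne_top hle).symm)
  exact ⟨q, hq, fun N hN hNM P _ _ hPN hqP => hqN N ⟨hN, hNM⟩ (hPN hqP)⟩

/-- The primes strictly below `M` form a chain, which by finite dimension has a top element `Q`; any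
`q ∈ M \ Q` works. -/
theorem IsPruferDomain.hasIsolatedMaximals [IsDomain R] (hR : IsPruferDomain R)
    (h : FiniteRingKrullDim R) : HasIsolatedMaximals R := by
  intro M hM hM0
  have hwf := (SetRel.IsWellFounded.inv_of_finiteDimensional
    (r := {(a, b) : PrimeSpectrum R × PrimeSpectrum R | a < b}))
  obtain ⟨Q, hQ, hmax⟩ := hwf.has_min {P : PrimeSpectrum R | P.asIdeal < M}
    ⟨⟨⊥, Ideal.isPrime_bot⟩, bot_lt_iff_ne_bot.2 hM0⟩
  have hQ : Q.asIdeal < M := hQ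
  obtain ⟨q, hqM, hqQ⟩ := SetLike.exists_of_lt hQ
  refine ⟨q, hqM, fun N hN hNM P hP hPM hPN hqP => ?_⟩
  have hlt : P < M := lt_of_le_of_ne hPM fun hPM' =>
    hNM (hM.eq_of_le hN.ne_top (hPM' ▸ hPN)).symm
  rcases hR.le_total_of_le_prime hM.isPrime hP Q.2 hPM hQ.le with hPQ | hQP
  · exact hqQ (hPQ hqP)
  · exact hmax ⟨P, hP⟩ hlt (lt_of_le_of_ne (show Q ≤ ⟨P, hP⟩ from hQP)
      fun hQP' => hqQ (by rw [hQP']; exact hqP))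

end Maximal

/-! ### Star operations and ⋆-invertible ideals -/

namespace StarOperation

variable {R K : Type*} [CommRing R] [IsDomain R] [Field K] [Algebra R K] [IsFractionRing R K]
  (s : StarOperation R K)

theorem toFun_le_one {I : FractionalIdeal R⁰ K} (h : I ≤ 1) : s.toFun I ≤ 1 :=
  s.map_one ▸ s.mono _ _ h

theorem mul_mem_toFun {I J : FractionalIdeal R⁰ K} {x y : K} (h : ∀ z ∈ I, y * z ∈ J)
    (hx : x ∈ s.toFun I) : y * x ∈ s.toFun J := by
  refine s.mono (spanSingleton R⁰ y * I) J (spanSingleton_mul_le_iff.2 h) ?_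
  rw [s.map_smul]
  exact mul_mem_mul (mem_spanSingleton_self _ y) hx

/-- Invertible fractional ideals are `⋆`-ideals. -/
theorem toFun_eq_of_isUnit {I : FractionalIdeal R⁰ K} (h : IsUnit I) : s.toFun I = I := by
  obtain ⟨J, hJ⟩ := h.exists_right_inv
  refine le_antisymm ?_ (s.le_map I)
  have hle : s.toFun I * J ≤ 1 := by
    refine FractionalIdeal.mul_le.2 fun x hx y hy => ?_
    rw [mul_comm, ← s.map_one]
    refine s.mul_mem_toFun (fun z hz => ?_) hx
    rw [← hJ, mul_comm y]
    exact mul_mem_mul hz hy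
  calc s.toFun I = s.toFun I * J * I := by rw [mul_assoc, mul_comm J, hJ, mul_one]
    _ ≤ 1 * I := by gcongr
    _ = I := one_mul I

/-- Multiplication by `x` maps `L` into `I`, hence `L^⋆ = R` into `I^⋆ = I`. -/
theorem mem_of_smul_mem {I : FractionalIdeal R⁰ K} (hI : s.IsStarIdeal I) {L : Ideal R}
    (hL : s.toFun (L : FractionalIdeal R⁰ K) = 1) {x : K} (h : ∀ r ∈ L, r • x ∈ I) : x ∈ I := by
  rw [hI, ← mul_one x]
  refine s.mul_mem_toFun (I := (L : FractionalIdeal R⁰ K)) (fun z hz => ?_)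
    (hL ▸ one_mem_one _)
  obtain ⟨r, hr, rfl⟩ := (mem_coeIdeal _).1 hz
  rw [mul_comm, ← Algebra.smul_def]
  exact h r hr

theorem toFun_eq_one_of_le {I J : FractionalIdeal R⁰ K} (hI : s.toFun I = 1) (hIJ : I ≤ J)
    (hJ : J ≤ 1) : s.toFun J = 1 :=
  le_antisymm (s.toFun_le_one hJ) (hI ▸ s.mono _ _ hIJ)

theorem toFun_mul_eq_one {I J : FractionalIdeal R⁰ K} (hI : s.toFun I = 1) (hJ : s.toFun J = 1) :
    s.toFun (I * J) = 1 := by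
  have hI1 : I ≤ 1 := hI ▸ s.le_map I
  have hJ1 : J ≤ 1 := hJ ▸ s.le_map J
  refine le_antisymm (s.toFun_le_one (mul_le_one' hI1 hJ1)) ?_
  rw [← s.map_map, ← hI]
  refine s.mono _ _ fun x hx => ?_
  rw [← mul_one x]
  exact s.mul_mem_toFun (fun z hz => mul_mem_mul hx hz) (hJ ▸ one_mem_one _)

variable {s}

theorem IsStarInvertible.ne_zero {I : FractionalIdeal R⁰ K} (h : s.IsStarInvertible I) : I ≠ 0 := by
  rintro rfl
  have h0 : s.toFun 0 = 0 := by simpa using s.map_smul 0 0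
  rw [IsStarInvertible, zero_mul, h0] at h
  exact zero_ne_one h

/-- Over a Prüfer domain, the sum of two `⋆`-invertible ideals is `⋆`-invertible. -/
theorem IsStarInvertible.add (hR : IsPruferDomain R) {I J : FractionalIdeal R⁰ K}
    (hI : s.IsStarInvertible I) (hJ : s.IsStarInvertible J) : s.IsStarInvertible (I + J) := by
  have hI0 := hI.ne_zero
  have hJ0 := hJ.ne_zero
  have hS0 : I + J ≠ 0 := fun h => hI0 (FractionalIdeal.le_zero_iff.1 (h ▸ le_self_add))
  have hmem : ∀ z, z ∈ 1 / I → z ∈ 1 / J → z ∈ 1 / (I + J) := by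
    intro z hzI hzJ
    rw [mem_div_iff_of_ne_zero hS0]
    intro y hy
    obtain ⟨i, hi, j, hj, rfl⟩ := (mem_add _ _ _).1 hy
    rw [mul_add]
    exact add_mem_of_mem ((mem_div_iff_of_ne_zero hI0).1 hzI i hi)
      ((mem_div_iff_of_ne_zero hJ0).1 hzJ j hj)
  refine s.toFun_eq_one_of_le (s.toFun_mul_eq_one hI hJ) ?_ mul_one_div_le_one
  have hprod : I * (1 / I) * (J * (1 / J)) = (I * J) * ((1 / I) * (1 / J)) := by ring
  rw [hprod]
  refine FractionalIdeal.mul_le.2 fun x hx y hy => ?_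
  refine FractionalIdeal.mul_induction_on hx (fun i hi j hj => ?_)
    (fun a b ha hb => by rw [add_mul a b y]; exact add_mem_of_mem ha hb)
  refine FractionalIdeal.mul_induction_on hy (fun i' hi' j' hj' => ?_)
    (fun a b ha hb => by rw [mul_add (i * j) a b]; exact add_mem_of_mem ha hb)
  have hiS : i ∈ I + J := (le_self_add : I ≤ I + J) hi
  have hjS : j ∈ I + J := (le_add_self : J ≤ I + J) hj
  have hii : i' * i ∈ (1 : FractionalIdeal R⁰ K) := (mem_div_iff_of_ne_zero hI0).1 hi' i hi
  have hjj : j' * j ∈ (1 : FractionalIdeal R⁰ K) := (mem_div_iff_of_ne_zero hJ0).1 hj' j hj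
  obtain ⟨a, ha⟩ := (mem_one_iff _).1 hii
  obtain ⟨b, hb⟩ := (mem_one_iff _).1 hjj
  -- Up to a factor outside `M`, one of `i'`, `j'` is a multiple of the other, so it lies in both
  -- inverses and hence in `(R : I + J)`.
  refine mem_of_forall_isMaximal fun M hM => ?_
  obtain ⟨t, ht, ⟨c, hc⟩ | ⟨c, hc⟩⟩ := hR.exists_smul_eq hM.isPrime i' j'
  · refine ⟨t, ht, ?_⟩
    have hz := hmem (t • i') (smul_mem_of_mem t hi') (hc ▸ smul_mem_of_mem c hj')
    have heq : t • (i * j * (i' * j')) = b • (i * t • i') := by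
      simp only [Algebra.smul_def, hb]
      ring
    rw [heq]
    exact smul_mem_of_mem b (mul_mem_mul hiS hz)
  · refine ⟨t, ht, ?_⟩
    have hz := hmem (t • j') (hc ▸ smul_mem_of_mem c hi') (smul_mem_of_mem t hj')
    have heq : t • (i * j * (i' * j')) = a • (j * t • j') := by
      simp only [Algebra.smul_def, ha]
      ring
    rw [heq]
    exact smul_mem_of_mem a (mul_mem_mul hjS hz)

/-- If `I` is `⋆`-invertible and `x` is in its closure, then the closure of `(I : x)` is `R`. -/
theorem IsStarInvertible.toFun_elementColon {I : FractionalIdeal R⁰ K} (hI : s.IsStarInvertible I)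
    {x : K} (hx : x ∈ s.toFun I) :
    s.toFun (I.elementColon x : FractionalIdeal R⁰ K) = 1 := by
  have hI0 := hI.ne_zero
  refine s.toFun_eq_one_of_le hI ?_ coeIdeal_le_one
  -- `I (R : I) ⊆ (I : x)`: since `y I ⊆ R` forces `y x ∈ R`, also `i y x ∈ I`.
  refine FractionalIdeal.mul_le.2 fun i hi y hy => ?_
  have hy' := (mem_div_iff_of_ne_zero hI0).1 hy
  obtain ⟨a, ha⟩ := (mem_one_iff _).1 (hy' i hi)
  have hyx : y * x ∈ (1 : FractionalIdeal R⁰ K) := s.map_one ▸ s.mul_mem_toFun hy' hx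
  obtain ⟨b, hb⟩ := (mem_one_iff _).1 hyx
  refine (mem_coeIdeal _).2 ⟨a, ?_, by rw [ha, mul_comm]⟩
  have heq : a • x = b • i := by
    rw [Algebra.smul_def, Algebra.smul_def, ha, hb]
    ring
  rw [mem_elementColon, heq]
  exact smul_mem_of_mem b hi

/-- An ideal whose closure is `R` contains locally each maximal ideal. -/
theorem exists_mul_mem_of_toFun_eq_one (hR : IsPruferDomain R)
    (hfin : ∀ x : R, x ≠ 0 → {M : Ideal R | M.IsMaximal ∧ x ∈ M}.Finite)
    (hiso : HasIsolatedMaximals R) {L M : Ideal R}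
    (hL : s.toFun (L : FractionalIdeal R⁰ K) = 1) (hM : M.IsMaximal) {m : R} (hm : m ∈ M) :
    ∃ t ∉ M, t * m ∈ L := by
  by_contra! hmL
  have hm0 : m ≠ 0 := by
    rintro rfl
    exact hmL 1 hM.isPrime.one_notMem (by simp)
  have hdvd : ∀ l ∈ L, ∃ t ∉ M, ∃ c, t * l = c * m := by
    intro l hl
    obtain ⟨t, ht, hc | ⟨c, hc⟩⟩ := hR.exists_mul_eq hM.isPrime l m
    · exact ⟨t, ht, hc⟩
    · exact absurd (hc ▸ L.mul_mem_left c hl) (hmL t ht)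
  obtain ⟨q, hqM, hq⟩ := hiso M hM ((Submodule.ne_bot_iff _).2 ⟨m, hm, hm0⟩)
  -- Take for `n` whichever of `q`, `m` divides the other at `M`: it keeps `L ⊆ n R_M` and inherits
  -- the isolation of `q`.
  obtain ⟨n, hnM, hn0, hn, hLn⟩ : ∃ n ∈ M, n ≠ 0 ∧
      (∀ N : Ideal R, N.IsMaximal → N ≠ M → ∀ P : Ideal R, P.IsPrime → P ≤ M → P ≤ N → n ∉ P) ∧
      ∀ l ∈ L, ∃ t ∉ M, ∃ c, t * l = c * n := by
    obtain ⟨t, ht, ⟨c, hc⟩ | ⟨c, hc⟩⟩ := hR.exists_mul_eq hM.isPrime q m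
    · refine ⟨m, hm, hm0, fun N hN hNM P hP hPM hPN hmP => ?_, hdvd⟩
      rcases hP.mem_or_mem (hc ▸ P.mul_mem_left c hmP : t * q ∈ P) with h | h
      · exact ht (hPM h)
      · exact hq N hN hNM P hP hPM hPN h
    · refine ⟨q, hqM, ?_, hq, fun l hl => ?_⟩
      · rintro rfl
        rw [mul_zero, mul_eq_zero] at hc
        exact hc.elim (fun h => ht (h ▸ M.zero_mem)) hm0
      · obtain ⟨t', ht', c', hc'⟩ := hdvd l hl
        refine ⟨t * t', hM.isPrime.mul_notMem ht ht', c' * c, ?_⟩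
        linear_combination t * hc' + c' * hc
  -- `A` is `n R_M ∩ R`.
  let A : Ideal R :=
    { carrier := {r | ∃ t ∉ M, ∃ c, t * r = c * n}
      add_mem' := by
        rintro a b ⟨t, ht, c, hc⟩ ⟨t', ht', c', hc'⟩
        exact ⟨t * t', hM.isPrime.mul_notMem ht ht', c * t' + t * c',
          by linear_combination t' * hc + t * hc'⟩
      zero_mem' := ⟨1, hM.isPrime.one_notMem, 0, by simp⟩
      smul_mem' := by
        rintro r a ⟨t, ht, c, hc⟩
        exact ⟨t, ht, r * c, by rw [smul_eq_mul]; linear_combination r * hc⟩ }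
  have hAM : A ≤ M := by
    rintro r ⟨t, ht, c, hc⟩
    exact (hM.isPrime.mem_or_mem (hc ▸ M.mul_mem_left c hnM : t * r ∈ M)).resolve_left ht
  -- With `b` in `A` but outside every other maximal ideal containing `n`, the ideal `(n, b)` is `n
  -- R_M` at `M` and trivial elsewhere, so it contains `L`.
  obtain ⟨b, hbA, hb⟩ := Ideal.exists_mem_forall_notMem_of_finite (I := A)
    (T := {N | (N.IsMaximal ∧ n ∈ N) ∧ N ≠ M}) ((hfin n hn0).subset fun N hN => hN.1)
    (fun N hN => hN.1.1.isPrime) (fun N hN hAN => by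
      obtain ⟨t, ht, r, hr, htr⟩ := Ideal.exists_mul_mem_of_forall_isPrime hM.isPrime
        hN.1.1.isPrime (I := Ideal.span {n}) (fun P hP hPM hPN hle =>
          hn N hN.1.1 hN.2 P hP hPM hPN (hle (Ideal.mem_span_singleton_self n)))
      obtain ⟨c, hc⟩ := Ideal.mem_span_singleton'.1 htr
      exact hr (hAN ⟨t, ht, c, hc.symm⟩))
  have hn1 : n ∈ Ideal.span {n, b} := Ideal.subset_span (by simp)
  have hb1 : b ∈ Ideal.span {n, b} := Ideal.subset_span (by simp)
  have hspanM : Ideal.span {n, b} ≤ M := by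
    rw [Ideal.span_le]
    rintro x (rfl | rfl)
    · exact hnM
    · exact hAM hbA
  have hLspan : (L : FractionalIdeal R⁰ K) ≤ (Ideal.span {n, b} : Ideal R) := by
    intro x hx
    obtain ⟨l, hl, rfl⟩ := (mem_coeIdeal _).1 hx
    refine mem_of_forall_isMaximal fun N hN => ?_
    suffices ∃ t ∉ N, t * l ∈ Ideal.span {n, b} by
      obtain ⟨t, ht, htl⟩ := this
      exact ⟨t, ht, by rw [Algebra.smul_def, ← map_mul]; exact mem_coeIdeal_of_mem _ htl⟩
    by_cases hNM : N = M
    · obtain ⟨t, ht, c, hc⟩ := hLn l hl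
      exact ⟨t, hNM ▸ ht, hc ▸ Ideal.mul_mem_left _ c hn1⟩
    · by_cases hnN : n ∈ N
      · exact ⟨b, hb N ⟨⟨hN, hnN⟩, hNM⟩, Ideal.mul_mem_right l _ hb1⟩
      · exact ⟨n, hnN, Ideal.mul_mem_right l _ hn1⟩
  have hone := s.toFun_eq_one_of_le hL hLspan coeIdeal_le_one
  rw [s.toFun_eq_of_isUnit (hR.isUnit_coeIdeal K ((Submodule.ne_bot_iff _).2 ⟨n, hn1, hn0⟩)
    (Submodule.fg_span (by simp))), ← coeIdeal_top (S := R⁰) (P := K), coeIdeal_inj] at hone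
  exact hM.ne_top (top_le_iff.1 (hone ▸ hspanM))

/-- If the maximal ideal `M` has closure `R` and `M x` lies locally at `M` in the `⋆`-ideal `I`,
then so does `x`. -/
theorem IsStarIdeal.exists_smul_mem
    (hfin : ∀ x : R, x ≠ 0 → {M : Ideal R | M.IsMaximal ∧ x ∈ M}.Finite)
    {I : FractionalIdeal R⁰ K} (hI : s.IsStarIdeal I) (hI0 : I ≠ 0) {M : Ideal R}
    (hM : M.IsMaximal) (hMs : s.toFun (M : FractionalIdeal R⁰ K) = 1) {x : K}
    (hx : ∀ m ∈ M, ∃ t ∉ M, t • m • x ∈ I) : ∃ t ∉ M, t • x ∈ I := by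
  classical
  obtain ⟨d, hdI, hd0⟩ := (Submodule.ne_bot_iff _).1 (elementColon_ne_bot hI0 x)
  have hloc : ∀ N : Ideal R, N.IsMaximal → N ≠ M → ∃ t ∉ M, ∃ r ∉ N, (t * r) • x ∈ I := by
    intro N hN hNM
    -- A prime inside `M ∩ N` containing `(I : x)` would contain `M`, forcing `M = N`.
    refine Ideal.exists_mul_mem_of_forall_isPrime hM.isPrime hN.isPrime (I := I.elementColon x)
      fun P hP hPM hPN hle => hNM (hM.eq_of_le hN.ne_top (le_trans (fun m hm => ?_) hPN)).symm
    obtain ⟨t, ht, htm⟩ := hx m hm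
    rw [smul_smul] at htm
    exact (hP.mem_or_mem (hle (mem_elementColon.2 htm))).resolve_left fun h => ht (hPM h)
  choose! f hf g hg hfg using hloc
  have hT : {N : Ideal R | (N.IsMaximal ∧ d ∈ N) ∧ N ≠ M}.Finite :=
    (hfin d hd0).subset fun N hN => hN.1
  -- The product sends `M x` into `I` locally everywhere: by `hx` at `M`, by the factor `f N` where
  -- `d ∈ N`, and by `d` elsewhere.
  refine ⟨∏ N ∈ hT.toFinset, f N, ?_, s.mem_of_smul_mem hI hMs fun m hm => ?_⟩
  · intro hprod
    obtain ⟨N, hN, hfN⟩ := (hM.isPrime.prod_mem_iff).1 hprod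
    have hN' := hT.mem_toFinset.1 hN
    exact hf N hN'.1.1 hN'.2 hfN
  · refine mem_of_forall_isMaximal fun N hN => ?_
    by_cases hNM : N = M
    · obtain ⟨t, ht, htm⟩ := hx m hm
      refine ⟨t, hNM ▸ ht, ?_⟩
      rw [smul_comm m, smul_comm t]
      exact smul_mem_of_mem _ htm
    by_cases hdN : d ∈ N
    · refine ⟨g N, hg N hN hNM, ?_⟩
      obtain ⟨e, he⟩ := Finset.dvd_prod_of_mem f (hT.mem_toFinset.2 ⟨⟨hN, hdN⟩, hNM⟩)
      have heq : g N • m • (∏ N ∈ hT.toFinset, f N) • x = (m * e) • (f N * g N) • x := by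
        rw [he]
        simp only [smul_smul]
        congr 1
        ring
      rw [heq]
      exact smul_mem_of_mem _ (hfg N hN hNM)
    · refine ⟨d, hdN, ?_⟩
      rw [smul_comm d, smul_comm d]
      exact smul_mem_of_mem _ (smul_mem_of_mem _ (mem_elementColon.1 hdI))

/-- In a Prüfer domain, if `M x` lies locally at `M` in `I + J`, then it lies locally at `M` in `I`
or in `J`. -/
theorem exists_smul_mem_or_exists_smul_mem (hR : IsPruferDomain R) {I J : FractionalIdeal R⁰ K}
    {M : Ideal R} (hM : M.IsPrime) {x : K} (hx : ∀ m ∈ M, ∃ t ∉ M, t • m • x ∈ I + J) :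
    (∀ m ∈ M, ∃ t ∉ M, t • m • x ∈ I) ∨ ∀ m ∈ M, ∃ t ∉ M, t • m • x ∈ J := by
  have hor : ∀ m ∈ M, (∃ t ∉ M, t • m • x ∈ I) ∨ ∃ t ∉ M, t • m • x ∈ J := by
    intro m hm
    obtain ⟨t, ht, htm⟩ := hx m hm
    obtain ⟨i, hi, j, hj, hij⟩ := (mem_add _ _ _).1 htm
    obtain ⟨u, hu, ⟨c, hc⟩ | ⟨c, hc⟩⟩ := hR.exists_smul_eq hM i j
    · refine Or.inr ⟨u * t, hM.mul_notMem hu ht, ?_⟩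
      rw [mul_smul, ← hij, smul_add, hc]
      exact add_mem_of_mem (smul_mem_of_mem _ hj) (smul_mem_of_mem _ hj)
    · refine Or.inl ⟨u * t, hM.mul_notMem hu ht, ?_⟩
      rw [mul_smul, ← hij, smul_add, hc]
      exact add_mem_of_mem (smul_mem_of_mem _ hi) (smul_mem_of_mem _ hi)
  have htrans : ∀ (A : FractionalIdeal R⁰ K) (m m' c u : R), u ∉ M → u * m = c * m' →
      (∃ t ∉ M, t • m' • x ∈ A) → ∃ t ∉ M, t • m • x ∈ A := by
    rintro A m m' c u hu hc ⟨t, ht, htm⟩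
    refine ⟨t * u, hM.mul_notMem ht hu, ?_⟩
    have heq : (t * u) • m • x = c • t • m' • x := by
      simp only [smul_smul]
      congr 1
      linear_combination t * hc
    rw [heq]
    exact smul_mem_of_mem c htm
  by_contra h
  rw [not_or] at h
  obtain ⟨h₁, h₂⟩ := h
  rw [not_forall₂] at h₁ h₂
  obtain ⟨m, hm, hmI⟩ := h₁
  obtain ⟨n, hn, hnJ⟩ := h₂
  -- Of the two counterexamples, the one that divides the other at `M` fails for both `I` and `J`,
  -- against `hor`.
  obtain ⟨u, hu, ⟨c, hc⟩ | ⟨c, hc⟩⟩ := hR.exists_mul_eq hM m n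
  · exact (hor n hn).elim (fun h => hmI (htrans I m n c u hu hc h)) hnJ
  · exact (hor m hm).elim hmI fun h => hnJ (htrans J n m c u hu hc h)

theorem add_mem_Inv (hR : IsPruferDomain R)
    (hfin : ∀ x : R, x ≠ 0 → {M : Ideal R | M.IsMaximal ∧ x ∈ M}.Finite)
    (hiso : HasIsolatedMaximals R) {I J : FractionalIdeal R⁰ K} (hI : I ∈ s.Inv) (hJ : J ∈ s.Inv) :
    I + J ∈ s.Inv := by
  have hinv : s.IsStarInvertible (I + J) := hI.2.add hR hJ.2
  refine ⟨le_antisymm (s.le_map _) fun x hx => ?_, hinv⟩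
  by_contra hxS
  have hL := hinv.toFun_elementColon hx
  have hne : (I + J).elementColon x ≠ ⊤ := fun htop =>
    hxS (by simpa [mem_elementColon] using (Ideal.eq_top_iff_one _).1 htop)
  obtain ⟨M, hM, hLM⟩ := Ideal.exists_le_maximal _ hne
  have hMs : s.toFun (M : FractionalIdeal R⁰ K) = 1 :=
    s.toFun_eq_one_of_le hL ((coeIdeal_le_coeIdeal K).2 hLM) coeIdeal_le_one
  have hloc : ∀ m ∈ M, ∃ t ∉ M, t • m • x ∈ I + J := by
    intro m hm
    obtain ⟨t, ht, htm⟩ := exists_mul_mem_of_toFun_eq_one hR hfin hiso hL hM hm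
    exact ⟨t, ht, by rw [smul_smul]; exact htm⟩
  rcases exists_smul_mem_or_exists_smul_mem hR hM.isPrime hloc with h | h
  · obtain ⟨t, ht, htx⟩ := hI.1.exists_smul_mem hfin hI.2.ne_zero hM hMs h
    exact ht (hLM ((le_self_add : I ≤ I + J) htx))
  · obtain ⟨t, ht, htx⟩ := hJ.1.exists_smul_mem hfin hJ.2.ne_zero hM hMs h
    exact ht (hLM ((le_add_self : J ≤ I + J) htx))

end StarOperation

theorem mainTheorem9 {R K : Type*} [CommRing R] [IsDomain R] [Field K] [Algebra R K]
    [IsFractionRing R K] (hR : IsPruferDomain R)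
    (h : IsSemilocal R ∨ (FiniteRingKrullDim R ∧ HasFiniteCharacter R))
    (s : StarOperation R K) (I J : FractionalIdeal R⁰ K) (hI : I ∈ s.Inv) (hJ : J ∈ s.Inv) :
    I + J ∈ s.Inv := by
  rcases h with h | ⟨hdim, hchar⟩
  · exact StarOperation.add_mem_Inv hR
      (fun x _ => h.finite_setOf_isMaximal.subset fun M hM => hM.1) h.hasIsolatedMaximals hI hJ
  · exact StarOperation.add_mem_Inv hR (fun x hx => hchar.finite_setOf_mem hx)
      (hR.hasIsolatedMaximals hdim) hI hJ
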